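/- Let $p$ be a prime, $q=p^m$ with $m\ge 1$, let $n\ge 1$ be odd, $r=(q^n+1)/(q+1)$, and let $K$ be an algebraically closed field of characteristic $p$. Let $C_n$ be the generalized GK-curve, i.e. the affine curve over $\mathbb F_{q^{2n}}$ in $3$-space with equations $x^q+x=y^{q+1}$ and $y^{q^2}-y=z^r$. Let $F$ be the two-variable polynomial over $K$ with $F(X+Y,XY)=(X^{q-1}-1)(Y^{q-1}-1)$. Let $Z\in K[t]$ be a polynomial with $Z(0)=0$ such that, for $w=Z^q+Z$, the identity $$t\,w\,F(t^r+w+w^q,\;w^{q+1})=(t^r-t)(t^{qr}-t)$$ holds in the polynomial ring $K[t]$. Then, for any point $P=(\alpha,\beta,\gamma)$ of $C_n$ with coordinates in $K$, and for $(a,b,c)=(\alpha^{q^n},\beta^{q^n},\gamma^{q^n})$, the surface $x+a=by+Z(cz)$ meets $C_n$ exactly in the points $P$ and $\Phi(P)=(\alpha^{q^{2n}},\beta^{q^{2n}},\gamma^{q^{2n}})$. If $P\neq\Phi(P)$, the intersection multiplicity is $q^n$ at $P$ and $1$ at $\Phi(P)$; if $P=\Phi(P)$, it is $q^n+1$ at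 $P$. In other words, the intersection divisor on the affine curve is $q^nP+\Phi(P)$. -/

import Mathlib

namespace GKCurve

open MvPolynomial

noncomputable section

/-- The exponent `r = (q ^ n + 1) / (q + 1)`; the division is exact for odd `n`. -/
def exponent (q n : ℕ) : ℕ := (q ^ n + 1) / (q + 1)

/-- The ideal of `K[x, y, z]` generated by the two equations `x ^ q + x = y ^ (q + 1)` and
`y ^ (q ^ 2) - y = z ^ r` of the generalized GK-curve, with `x = X 0`, `y = X 1`, `z = X 2`. -/
def curveIdeal (K : Type*) [Field K] (q n : ℕ) : Ideal (MvPolynomial (Fin 3) K) :=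
  Ideal.span
    {X 0 ^ q + X 0 - X 1 ^ (q + 1), X 1 ^ (q ^ 2) - X 1 - X 2 ^ exponent q n}

/-- The points of the affine generalized GK-curve with coordinates in `K`. -/
def curve (K : Type*) [Field K] (q n : ℕ) : Set (Fin 3 → K) :=
  zeroLocus K (curveIdeal K q n)

/-- The map raising all coordinates of a point to the power `N`. -/
def powPoint {K : Type*} [Field K] (N : ℕ) (P : Fin 3 → K) : Fin 3 → K := fun i => P i ^ N

/-- The polynomial `x + a - b y - Z(c z)` whose zero set is the surface `x + a = b y + Z`,
for `Z` a polynomial in the variable `t = c z`. -/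
def surface {K : Type*} [Field K] (Z : Polynomial K) (a b c : K) : MvPolynomial (Fin 3) K :=
  X 0 + C a - C b * X 1 - Polynomial.aeval (C c * X 2) Z

/-- The intersection multiplicity at the point `P` of the subscheme of affine 3-space with
ideal `I` and the surface `h = 0`: the length of `O_P / (I, h) O_P`, where `O_P` is the local
ring of affine 3-space at `P`. It is `⊤` when this length is infinite. -/
def intersectionMultiplicity {K : Type*} [Field K] (I : Ideal (MvPolynomial (Fin 3) K))
    (h : MvPolynomial (Fin 3) K) (P : Fin 3 → K) : ℕ∞ :=
  Module.length (Localization.AtPrime (vanishingIdeal K {P}))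
    (Localization.AtPrime (vanishingIdeal K {P}) ⧸
      (I ⊔ Ideal.span {h}).map
        (algebraMap (MvPolynomial (Fin 3) K) (Localization.AtPrime (vanishingIdeal K {P}))))

end

end GKCurve

/-!
Write `N = q ^ n`, `t = c z`, `u = y - b ^ q` and `v = y ^ q - b`. On the curve,
`v - u ^ q = c ^ r` and `v ^ q - u = z ^ r`, and the surface equation `g = x + a - b y - Z(t)`
satisfies `g ^ q + g = u v - w(t)`.

*Upper bounds.* Put `G(s) = s F(t ^ r + s + s ^ q, s ^ (q + 1))`. The defining property of `F` gives
`G(u v) = (u ^ (q ^ 2) - u) (v ^ (q ^ 2) - v) = (z ^ r - c ^ (q r)) (z ^ (q r) - c ^ r)`, and the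
identity for `Z` gives `G(w) = (t ^ (r - 1) - 1) (t ^ (q r) - t)`, so that
`G(w) - G(u v) = -(z ^ N - c) (z - c ^ N)`. For `e` in the field with `q ^ 2` elements, replacing
`(u, v)` by `(u + e, v + e ^ q)` does not change `G(u v)`, so the left hand side is divisible by
the product of the `w - (u + e) (v + e ^ q)` over any set of such `e` (`IsAdmissible.prod_dvd`).
These translations permute the points of the curve over a given `z`. Therefore the multiplicities of the
intersection over a given `z` add up to at most the order there of `(z ^ N - c) (z - c ^ N)`
(`IsAdmissible.X_pow_sum_dvd`).

*Lower bounds.* The identity for `Z` determines `Z` (`IsAdmissible.expand_Z`), with the consequence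
that `x + x ^ N = y ^ (N + 1) + Z(z ^ (N + 1))` on the curve (`IsAdmissible.add_pow_eq`). So `P` and
`Φ(P)` lie on the surface, and subtracting this relation from `g` shows that `g` has order at least
`N` at `P` (`IsAdmissible.X_pow_dvd_surface`), and at least `N + 1` if `P = Φ(P)`
(`IsAdmissible.X_pow_succ_dvd_surface`). Upper and lower bounds agree.

Orders are computed on branches with values in `K⟦X⟧`, which exist by Hensel's lemma as the curve is
étale over the `z`-line; they are the intersection multiplicities by
`intersectionMultiplicity_eq_of_branch`.
-/

namespace GKCurve

/-! ### Identities in a ring of characteristic `p` -/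

/-- On two points of `x ^ q + x = y ^ (q + 1)`, the Artin-Schreier type operator `g ↦ g ^ q + g`
turns the equation of the surface into one that does not involve `x` and `a`. -/
theorem surface_pow_add_self {S : Type*} [CommRing S] {p : ℕ} [ExpChar S p] (m : ℕ)
    {x y a b : S} (hxy : x ^ p ^ m + x = y ^ (p ^ m + 1)) (hab : a ^ p ^ m + a = b ^ (p ^ m + 1))
    (s : S) :
    (x + a - b * y - s) ^ p ^ m + (x + a - b * y - s) =
      (y - b ^ p ^ m) * (y ^ p ^ m - b) - (s ^ p ^ m + s) := by
  rw [sub_pow_expChar_pow, sub_pow_expChar_pow, add_pow_expChar_pow, mul_pow]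
  linear_combination hxy + hab

theorem curve_pow_pow {S : Type*} [CommRing S] {p : ℕ} [ExpChar S p] (m : ℕ)
    {x y : S} (hxy : x ^ p ^ m + x = y ^ (p ^ m + 1)) (i : ℕ) :
    x ^ (p ^ m) ^ (i + 1) + x ^ (p ^ m) ^ i = y ^ (p ^ m) ^ (i + 1) * y ^ (p ^ m) ^ i := by
  have h := congrArg (· ^ p ^ (m * i)) hxy
  simp only [add_pow_expChar_pow, ← pow_mul] at h
  rw [← pow_add]
  convert h using 2 <;> ring

/-- For odd `n = 2 l + 1`, the function `x + x ^ (q ^ n) - y ^ (q ^ n + 1)` is a polynomial in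
`y ^ (q ^ 2) - y`, that is, in `z ^ r`. -/
theorem add_pow_eq_sum {S : Type*} [CommRing S] {p : ℕ} [ExpChar S p] (m : ℕ)
    {x y : S} (hxy : x ^ p ^ m + x = y ^ (p ^ m + 1)) (l : ℕ) :
    x + x ^ (p ^ m) ^ (2 * l + 1) = y ^ ((p ^ m) ^ (2 * l + 1) + 1) +
      ∑ i ∈ Finset.range l,
        (∑ j ∈ Finset.range (i + 1), (y ^ (p ^ m) ^ 2 - y) ^ (p ^ m) ^ (2 * j)) *
          (y ^ (p ^ m) ^ 2 - y) ^ (p ^ m) ^ (2 * i + 1) := by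
  have hpow : ∀ i, (y ^ (p ^ m) ^ 2 - y) ^ (p ^ m) ^ i =
      y ^ (p ^ m) ^ (i + 2) - y ^ (p ^ m) ^ i := fun i => by
    rw [← pow_mul p m i, sub_pow_expChar_pow, pow_mul p m i, ← pow_mul]
    congr 2; ring
  have hsum : ∀ i, ∑ j ∈ Finset.range (i + 1), (y ^ (p ^ m) ^ 2 - y) ^ (p ^ m) ^ (2 * j) =
      y ^ (p ^ m) ^ (2 * i + 2) - y := fun i => by
    simp only [hpow]
    have := Finset.sum_range_sub (fun j => y ^ (p ^ m) ^ (2 * j)) (i + 1)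
    simpa [mul_add] using this
  induction l with
  | zero => simpa [add_comm] using hxy
  | succ l ih =>
    rw [Finset.sum_range_succ, ← add_assoc, hsum, hpow]
    have h1 := curve_pow_pow m hxy (2 * l + 1)
    have h2 := curve_pow_pow m hxy (2 * l + 2)
    rw [show 2 * (l + 1) + 1 = 2 * l + 3 by ring]
    simp only [pow_succ y ((p ^ m) ^ _)] at *
    simp only [show 2 * l + 1 + 1 = 2 * l + 2 by ring, show 2 * l + 2 + 1 = 2 * l + 3 by ring] at *
    linear_combination ih + h2 - h1

/-! ### The polynomial `F` -/

section

open Polynomial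

variable {K : Type*} [Field K] {q : ℕ} {F : MvPolynomial (Fin 2) K}

theorem aeval_add_mul
    (hF : MvPolynomial.aeval
        ![MvPolynomial.X 0 + MvPolynomial.X 1, MvPolynomial.X 0 * MvPolynomial.X 1] F =
      ((MvPolynomial.X 0 ^ (q - 1) - 1) * (MvPolynomial.X 1 ^ (q - 1) - 1) :
        MvPolynomial (Fin 2) K))
    {S : Type*} [CommRing S] [Algebra K S] (s t : S) :
    MvPolynomial.aeval ![s + t, s * t] F = (s ^ (q - 1) - 1) * (t ^ (q - 1) - 1) := by
  have h := congrArg (MvPolynomial.aeval ![s, t]) hF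
  rw [← AlgHom.comp_apply, MvPolynomial.comp_aeval] at h
  convert h using 2
  · congr 1
    ext i
    fin_cases i <;> simp
  · simp

theorem map_aeval_pair {S T : Type*} [CommRing S] [Algebra K S] [CommRing T] [Algebra K T]
    (φ : S →ₐ[K] T) (s t : S) :
    φ (MvPolynomial.aeval ![s, t] F) = MvPolynomial.aeval ![φ s, φ t] F := by
  rw [← AlgHom.comp_apply, MvPolynomial.comp_aeval]
  congr 2
  ext i
  fin_cases i <;> simp

theorem mul_mul_aeval (hq : 2 ≤ q)
    (hF : MvPolynomial.aeval
        ![MvPolynomial.X 0 + MvPolynomial.X 1, MvPolynomial.X 0 * MvPolynomial.X 1] F =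
      ((MvPolynomial.X 0 ^ (q - 1) - 1) * (MvPolynomial.X 1 ^ (q - 1) - 1) :
        MvPolynomial (Fin 2) K))
    {S : Type*} [CommRing S] [Algebra K S] (u v : S) :
    u * v * MvPolynomial.aeval ![u ^ (q + 1) + v ^ (q + 1), (u * v) ^ (q + 1)] F =
      (u ^ q ^ 2 - u) * (v ^ q ^ 2 - v) := by
  have key : ∀ s : S, s * ((s ^ (q + 1)) ^ (q - 1) - 1) = s ^ q ^ 2 - s := fun s => by
    rw [mul_sub, mul_one, ← pow_mul, ← pow_succ', ← Nat.sq_sub_sq q 1]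
    rw [Nat.sub_add_cancel (by nlinarith)]
  rw [mul_pow, aeval_add_mul hF, ← key, ← key]
  ring

theorem aeval_zero_zero (hq : 2 ≤ q)
    (hF : MvPolynomial.aeval
        ![MvPolynomial.X 0 + MvPolynomial.X 1, MvPolynomial.X 0 * MvPolynomial.X 1] F =
      ((MvPolynomial.X 0 ^ (q - 1) - 1) * (MvPolynomial.X 1 ^ (q - 1) - 1) :
        MvPolynomial (Fin 2) K)) :
    MvPolynomial.aeval ![(0 : K), 0] F = 1 := by
  have h := aeval_add_mul hF (0 : K) 0
  rw [zero_pow (by omega)] at h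
  simpa using h

/-- The quantities `u = y - b ^ q` and `v = y ^ q - b` satisfy `v - u ^ q = c ^ r` and
`v ^ q - u = z ^ r` on the curve. Hence the first argument of `F` is `t ^ r + s + s ^ q` for
`s = u v` and `t = c z`, and it also equals `u ^ (q + 1) + v ^ (q + 1)`. -/
theorem pair_identity {p : ℕ} {S : Type*} [CommRing S] [Algebra K S] [ExpChar S p] (m : ℕ)
    (hq : 2 ≤ p ^ m)
    (hF : MvPolynomial.aeval
        ![MvPolynomial.X 0 + MvPolynomial.X 1, MvPolynomial.X 0 * MvPolynomial.X 1] F =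
      ((MvPolynomial.X 0 ^ (p ^ m - 1) - 1) * (MvPolynomial.X 1 ^ (p ^ m - 1) - 1) :
        MvPolynomial (Fin 2) K)) (u v : S) :
    u * v * MvPolynomial.aeval
        ![(v - u ^ p ^ m) * (v ^ p ^ m - u) + u * v + (u * v) ^ p ^ m, (u * v) ^ (p ^ m + 1)] F =
      (u ^ (p ^ m) ^ 2 - u) * (v ^ (p ^ m) ^ 2 - v) := by
  rw [← mul_mul_aeval hq hF]
  congr 4
  ring

/-- The right hand side is a polynomial in `s`, and all `(U + e) (V + e ^ q)` with `e` in the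
field of `q ^ 2` elements are roots of it, since a translation by `(e, e ^ q)` changes neither
`V - U ^ q` nor `V ^ q - U`. Distinct roots in a domain give a product of linear factors. -/
theorem prod_dvd_of_injective {p : ℕ} {A S : Type*} [CommRing A] [IsDomain A] [Algebra K A]
    [ExpChar A p] [CommRing S] [Algebra K S] (m : ℕ) (hq : 2 ≤ p ^ m)
    (hF : MvPolynomial.aeval
        ![MvPolynomial.X 0 + MvPolynomial.X 1, MvPolynomial.X 0 * MvPolynomial.X 1] F =
      ((MvPolynomial.X 0 ^ (p ^ m - 1) - 1) * (MvPolynomial.X 1 ^ (p ^ m - 1) - 1) :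
        MvPolynomial (Fin 2) K))
    (E : Finset K) (hE : ∀ e ∈ E, e ^ (p ^ m) ^ 2 = e) (U V : A)
    (hρ : Function.Injective fun e : K => (U + algebraMap K A e) * (V + algebraMap K A e ^ p ^ m))
    (φ : A →ₐ[K] S) (s : S) :
    ∏ e ∈ E, (s - (φ U + algebraMap K S e) * (φ V + algebraMap K S e ^ p ^ m)) ∣
      s * MvPolynomial.aeval ![(φ V - φ U ^ p ^ m) * (φ V ^ p ^ m - φ U) + s + s ^ p ^ m,
        s ^ (p ^ m + 1)] F - (φ U ^ (p ^ m) ^ 2 - φ U) * (φ V ^ (p ^ m) ^ 2 - φ V) := by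
  let f : A[X] := X * MvPolynomial.aeval
        ![C ((V - U ^ p ^ m) * (V ^ p ^ m - U)) + X + X ^ p ^ m, X ^ (p ^ m + 1)] F -
      C ((U ^ (p ^ m) ^ 2 - U) * (V ^ (p ^ m) ^ 2 - V))
  let ρ : K → A := fun e => (U + algebraMap K A e) * (V + algebraMap K A e ^ p ^ m)
  have hroot : ∀ e ∈ E, f.eval (ρ e) = 0 := by
    intro e he
    have h := pair_identity (S := A) m hq hF (U + algebraMap K A e) (V + algebraMap K A e ^ p ^ m)
    have he2 : (algebraMap K A e ^ p ^ m) ^ p ^ m = algebraMap K A e := by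
      rw [← pow_mul, ← sq, ← map_pow, hE e he]
    have he3 : algebraMap K A e ^ p ^ (m * 2) = algebraMap K A e := by
      rw [pow_mul, ← map_pow, hE e he]
    have e1 : V + algebraMap K A e ^ p ^ m - (U + algebraMap K A e) ^ p ^ m = V - U ^ p ^ m := by
      rw [add_pow_expChar_pow]; ring
    have e2 : (V + algebraMap K A e ^ p ^ m) ^ p ^ m - (U + algebraMap K A e) = V ^ p ^ m - U := by
      rw [add_pow_expChar_pow, he2]; ring
    have e3 : (U + algebraMap K A e) ^ (p ^ m) ^ 2 - (U + algebraMap K A e) =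
        U ^ (p ^ m) ^ 2 - U := by
      rw [← pow_mul, add_pow_expChar_pow, he3]; ring
    have e4 : (V + algebraMap K A e ^ p ^ m) ^ (p ^ m) ^ 2 - (V + algebraMap K A e ^ p ^ m) =
        V ^ (p ^ m) ^ 2 - V := by
      rw [← pow_mul, add_pow_expChar_pow, pow_right_comm, he3]; ring
    rw [e1, e2, e3, e4] at h
    have h2 := map_aeval_pair (F := F) ((aeval (R := A) (ρ e)).restrictScalars K)
      (C ((V - U ^ p ^ m) * (V ^ p ^ m - U)) + X + X ^ p ^ m) (X ^ (p ^ m + 1))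
    simp only [AlgHom.restrictScalars_apply, coe_aeval_eq_eval] at h2
    simp only [f, eval_sub, eval_mul, eval_X, eval_C, h2, eval_add, eval_pow]
    rw [sub_eq_zero]
    exact h
  have hdvd : ∏ e ∈ E, (X - C (ρ e)) ∣ f := by
    by_cases hf : f = 0
    · rw [hf]; exact dvd_zero _
    have := (Multiset.prod_X_sub_C_dvd_iff_le_roots hf (E.val.map ρ)).2 <| by
      rw [Multiset.le_iff_subset (E.nodup.map hρ)]
      intro x hx
      obtain ⟨e, he, rfl⟩ := Multiset.mem_map.1 hx
      exact (mem_roots hf).2 (hroot e he)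
    rwa [Multiset.map_map] at this
  let ψ : A[X] →ₐ[K] S := eval₂AlgHom φ s (fun _ => Commute.all _ _)
  have hψC : ∀ g : A, ψ (C g) = φ g := fun g => eval₂_C _ _
  have hψX : ψ X = s := eval₂_X _ _
  have h := map_dvd ψ hdvd
  rw [map_prod] at h
  simpa only [f, ρ, map_sub, map_mul, map_add, map_pow, map_aeval_pair, hψC, hψX,
    AlgHom.commutes] using h

theorem prod_dvd {p : ℕ} [ExpChar K p] {S : Type*} [CommRing S] [Algebra K S] (m : ℕ)
    (hq : 2 ≤ p ^ m)
    (hF : MvPolynomial.aeval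
        ![MvPolynomial.X 0 + MvPolynomial.X 1, MvPolynomial.X 0 * MvPolynomial.X 1] F =
      ((MvPolynomial.X 0 ^ (p ^ m - 1) - 1) * (MvPolynomial.X 1 ^ (p ^ m - 1) - 1) :
        MvPolynomial (Fin 2) K))
    (E : Finset K) (hE : ∀ e ∈ E, e ^ (p ^ m) ^ 2 = e) (u v s : S) :
    ∏ e ∈ E, (s - (u + algebraMap K S e) * (v + algebraMap K S e ^ p ^ m)) ∣
      s * MvPolynomial.aeval
        ![(v - u ^ p ^ m) * (v ^ p ^ m - u) + s + s ^ p ^ m, s ^ (p ^ m + 1)] F -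
      (u ^ (p ^ m) ^ 2 - u) * (v ^ (p ^ m) ^ 2 - v) := by
  -- In the generic case `u` and `v - u ^ q` are indeterminates.
  have : ExpChar K[X][X] p :=
    expChar_of_injective_algebraMap (algebraMap K K[X][X]).injective p
  let φ : K[X][X] →ₐ[K] S := eval₂AlgHom (aeval u) (v - u ^ p ^ m) (fun _ => Commute.all _ _)
  have hU : φ (C X) = u := (eval₂_C _ _).trans (aeval_X u)
  have hX : φ X = v - u ^ p ^ m := eval₂_X _ _
  have hV : φ (C X ^ p ^ m + X) = v := by simp [map_add, map_pow, hU, hX]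
  have h := prod_dvd_of_injective m hq hF E hE (C X) (C X ^ p ^ m + X) ?_ φ s
  · rwa [hU, hV] at h
  · intro e e' h
    have hA : ∀ e : K, algebraMap K K[X][X] e = C (C e) := fun e => rfl
    have hexp : ∀ e : K, ((C X : K[X][X]) + algebraMap K K[X][X] e) *
        (C X ^ p ^ m + X + algebraMap K K[X][X] e ^ p ^ m) =
          C (X + C e) * X + C ((X + C e) * (X ^ p ^ m + C e ^ p ^ m)) := by
      intro e
      simp only [hA, map_add, map_mul, map_pow]
      ring
    simp only [hexp] at h
    have hc : ∀ a b : K[X], (C a * X + C b).coeff 1 = a := fun a b => by simp [coeff_C]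
    have h1 := congrArg (fun g : K[X][X] => (g.coeff 1).coeff 0) h
    simpa [hc, -map_mul, -map_add] using h1

end

/-! ### Branches and local multiplicities -/

section

open PowerSeries

theorem aeval_X_eq_coe {K : Type*} [Field K] (f : Polynomial K) :
    Polynomial.aeval (X : K⟦X⟧) f = f := by
  induction f using Polynomial.induction_on' with
  | add f g hf hg => simp [hf, hg]
  | monomial k a => simp [← Polynomial.C_mul_X_pow_eq_monomial]

theorem exists_root_add_mul {K : Type*} [Field K] {Q : ℕ} (hQ : 2 ≤ Q) (hQ0 : (Q : K) = 0)
    {e : K} (he : e ≠ 0) (g : K⟦X⟧) {α : K} (h : α ^ Q + e * α = constantCoeff g) :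
    ∃ x : K⟦X⟧, constantCoeff x = α ∧ x ^ Q + C e * x = g := by
  let f : Polynomial K⟦X⟧ := Polynomial.X ^ Q + (Polynomial.C (C e) * Polynomial.X - Polynomial.C g)
  have hf : f.Monic := by
    refine Polynomial.monic_X_pow_add ?_
    have : (Polynomial.C (C e) * Polynomial.X - Polynomial.C g : Polynomial K⟦X⟧).degree ≤ 1 := by
      compute_degree
    exact this.trans_lt (by exact_mod_cast hQ)
  have hQS : (Q : K⟦X⟧) = 0 := by rw [← map_natCast (C (R := K)), hQ0, map_zero]
  obtain ⟨x, hx, hxα⟩ := HenselianRing.is_henselian (I := Ideal.span {(X : K⟦X⟧)}) f hf (C α)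
    (by
      rw [Ideal.mem_span_singleton, X_dvd_iff]
      simp [f, ← h])
    (by
      refine IsUnit.map _ ?_
      rw [isUnit_iff_constantCoeff]
      simp [f, hQS, he, Polynomial.derivative_X_pow])
  rw [Ideal.mem_span_singleton, X_dvd_iff, map_sub, sub_eq_zero] at hxα
  refine ⟨x, by simpa using hxα, ?_⟩
  have h2 : x ^ Q + (C e * x - g) = 0 := by simpa [f, Polynomial.IsRoot] using hx
  linear_combination h2

/-- The two equations of the curve are étale over the `z`-line, so each point has a branch
parametrized by `z`, here with parameter `X = z - γ`. -/
theorem exists_branch {K : Type*} [Field K] {q r : ℕ} (hq : 2 ≤ q) (hq0 : (q : K) = 0)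
    {α β γ : K} (h1 : α ^ q + α = β ^ (q + 1)) (h2 : β ^ q ^ 2 - β = γ ^ r) :
    ∃ x y : K⟦X⟧, constantCoeff x = α ∧ constantCoeff y = β ∧ x ^ q + x = y ^ (q + 1) ∧
      y ^ q ^ 2 - y = (C γ + X) ^ r := by
  obtain ⟨y, hy, hy'⟩ := exists_root_add_mul (K := K) (Q := q ^ 2) (by nlinarith)
    (by simp [hq0]) (e := -1) (by simp) ((C γ + X) ^ r) (α := β) (by simp [← h2, sub_eq_add_neg])
  obtain ⟨x, hx, hx'⟩ := exists_root_add_mul (K := K) hq hq0 (e := 1) one_ne_zero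
    (y ^ (q + 1)) (α := α) (by simp [hy, h1])
  refine ⟨x, y, hx, hy, by simpa using hx', ?_⟩
  rw [← hy', map_neg, map_one]
  ring

/-- Suppose that the maximal ideal is generated by `π` modulo an ideal `J` killed by `Θ`, and that
`Θ` maps `π` to `X`. Then the quotient by `J` and `h` is identified with the quotient of `K⟦X⟧` by
`Θ h`, so its length is the order of `Θ h`. -/
theorem length_quotient_of_order {K R : Type*} [Field K] [CommRing R] [IsLocalRing R]
    (Θ : R →+* K⟦X⟧) (hunit : ∀ s, constantCoeff (Θ s) ≠ 0 → IsUnit s)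
    (hsurj : ∀ (f : Polynomial K), ∃ s, Θ s = f)
    (J : Ideal R) (hJ : ∀ s ∈ J, Θ s = 0) (π : R) (hπ : Θ π = X)
    (hmax : IsLocalRing.maximalIdeal R ≤ J ⊔ Ideal.span {π})
    (h : R) (μ : ℕ) (g : K⟦X⟧) (hg : constantCoeff g ≠ 0) (hh : Θ h = X ^ μ * g) :
    Module.length R (R ⧸ (J ⊔ Ideal.span {h})) = (μ : ℕ∞) := by
  have hpow : ∀ (j : ℕ) (s : R), X ^ j ∣ Θ s → ∃ i ∈ J, ∃ t, s = i + π ^ j * t := by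
    intro j
    induction j with
    | zero => exact fun s _ => ⟨0, J.zero_mem, s, by simp⟩
    | succ j ih =>
      intro s hs
      obtain ⟨i, hi, t, rfl⟩ := ih s ((pow_dvd_pow _ j.le_succ).trans hs)
      rw [map_add, hJ i hi, zero_add, map_mul, map_pow, hπ, pow_succ] at hs
      have ht : X ∣ Θ t := (mul_dvd_mul_iff_left (pow_ne_zero j X_ne_zero)).1 hs
      have htm : t ∈ IsLocalRing.maximalIdeal R := by
        rw [IsLocalRing.mem_maximalIdeal, mem_nonunits_iff]
        intro hu
        exact ((hu.map Θ).map (constantCoeff (R := K))).ne_zero (X_dvd_iff.1 ht)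
      obtain ⟨i', hi', t', ht', rfl⟩ := Submodule.mem_sup.1 (hmax htm)
      obtain ⟨t'', rfl⟩ := Ideal.mem_span_singleton'.1 ht'
      exact ⟨i + π ^ j * i', J.add_mem hi (J.mul_mem_left _ hi'), t'', by ring⟩
  let Ψ : R →+* K⟦X⟧ ⧸ Ideal.span {(X : K⟦X⟧) ^ μ} := (Ideal.Quotient.mk _).comp Θ
  have hΨ : Function.Surjective Ψ := by
    intro f
    obtain ⟨f, rfl⟩ := Ideal.Quotient.mk_surjective f
    obtain ⟨s, hs⟩ := hsurj (trunc μ f)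
    refine ⟨s, ?_⟩
    simp only [Ψ, RingHom.comp_apply, hs]
    rw [Ideal.Quotient.eq, Ideal.mem_span_singleton, X_pow_dvd_iff]
    intro k hk
    simp [coeff_trunc, hk]
  have hker : RingHom.ker Ψ = J ⊔ Ideal.span {h} := by
    apply le_antisymm
    · intro s hs
      rw [RingHom.mem_ker, RingHom.comp_apply, Ideal.Quotient.eq_zero_iff_mem,
        Ideal.mem_span_singleton] at hs
      obtain ⟨i, hi, t, rfl⟩ := hpow μ s hs
      obtain ⟨i', hi', t', ht'⟩ := hpow μ h (hh ▸ dvd_mul_right _ _)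
      have htg : Θ t' = g := by
        rw [ht', map_add, hJ i' hi', zero_add, map_mul, map_pow, hπ] at hh
        exact mul_left_cancel₀ (pow_ne_zero μ X_ne_zero) hh
      obtain ⟨t', rfl⟩ := hunit t' (htg ▸ hg)
      have hπμ : π ^ μ = (h - i') * (t'⁻¹ : Rˣ) := by
        rw [ht']; simp [mul_assoc]
      rw [hπμ]
      refine Ideal.add_mem _ (Ideal.mem_sup_left hi) (Ideal.mul_mem_right _ _
        (Ideal.mul_mem_right _ _ (Ideal.sub_mem _ ?_ (Ideal.mem_sup_left hi'))))
      exact Ideal.mem_sup_right (Ideal.mem_span_singleton_self h)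
    · refine sup_le (fun s hs => ?_) ?_
      · rw [RingHom.mem_ker, RingHom.comp_apply, hJ s hs, map_zero]
      · rw [Ideal.span_singleton_le_iff_mem, RingHom.mem_ker, RingHom.comp_apply, hh,
          Ideal.Quotient.eq_zero_iff_mem]
        exact Ideal.mul_mem_right _ _ (Ideal.mem_span_singleton_self _)
  let B := K⟦X⟧ ⧸ Ideal.span {(X : K⟦X⟧) ^ μ}
  let : Algebra R B := Ψ.toAlgebra
  have e : (R ⧸ (J ⊔ Ideal.span {h})) ≃ₗ[R] B :=
    ((Ideal.quotientEquivAlgOfEq R hker.symm).trans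
      (Ideal.quotientKerAlgEquivOfSurjective (f := Algebra.ofId R B) hΨ)).toLinearEquiv
  rw [e.length_eq, Module.length_eq_of_surjective (R := B) (M := B) (S := R) hΨ,
    ← Module.length_eq_of_surjective (R := B) (M := B) (S := K⟦X⟧) Ideal.Quotient.mk_surjective]
  change Ring.ord K⟦X⟧ (X ^ μ) = _
  rw [Ring.ord_pow (mem_nonZeroDivisors_of_ne_zero X_ne_zero),
    Ring.ord_of_irreducible X_irreducible]
  simp

/-- The intersection multiplicity at a point of the curve is the order of the equation along the
branch through that point. -/
theorem intersectionMultiplicity_eq_of_branch {K : Type*} [Field K] {q n : ℕ} (hq0 : (q : K) = 0)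
    {P : Fin 3 → K} {x y : K⟦X⟧} (hx : constantCoeff x = P 0) (hy : constantCoeff y = P 1)
    (hxy : x ^ q + x = y ^ (q + 1)) (hyz : y ^ q ^ 2 - y = (C (P 2) + X) ^ exponent q n)
    (h : MvPolynomial (Fin 3) K) (μ : ℕ) (g : K⟦X⟧) (hg : constantCoeff g ≠ 0)
    (hh : MvPolynomial.aeval ![x, y, C (P 2) + X] h = X ^ μ * g) :
    intersectionMultiplicity (curveIdeal K q n) h P = μ := by
  let 𝔭 := MvPolynomial.vanishingIdeal K {P}
  let R := Localization.AtPrime 𝔭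
  let ι : MvPolynomial (Fin 3) K →+* R := algebraMap _ R
  let θ : MvPolynomial (Fin 3) K →ₐ[K] K⟦X⟧ := MvPolynomial.aeval ![x, y, C (P 2) + X]
  have hθ0 : θ (MvPolynomial.X 0) = x := by simp [θ]
  have hθ1 : θ (MvPolynomial.X 1) = y := by simp [θ]
  have hθ2 : θ (MvPolynomial.X 2) = C (P 2) + X := by simp [θ]
  have hθC : ∀ a, θ (MvPolynomial.C a) = C a := fun a => by
    rw [← MvPolynomial.algebraMap_eq, AlgHom.commutes]; rfl
  have hev : ∀ f, constantCoeff (θ f) = MvPolynomial.eval P f := by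
    have : (constantCoeff (R := K)).comp (θ : MvPolynomial (Fin 3) K →+* K⟦X⟧) =
        MvPolynomial.eval P := by
      refine MvPolynomial.ringHom_ext (fun a => ?_) (fun i => ?_)
      · simp [hθC]
      · fin_cases i
        · simpa [hθ0] using hx
        · simpa [hθ1] using hy
        · simp [hθ2]
    exact fun f => RingHom.congr_fun this f
  have hmem : ∀ f, f ∈ 𝔭 ↔ MvPolynomial.eval P f = 0 := fun f => by
    rw [MvPolynomial.mem_vanishingIdeal_singleton_iff]; rfl
  have hcompl : ∀ f, MvPolynomial.eval P f ≠ 0 → IsUnit (ι f) := fun f hf =>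
    (IsLocalization.AtPrime.isUnit_to_map_iff R 𝔭 f).2 fun hf' => hf ((hmem f).1 hf')
  have hunit : ∀ s : 𝔭.primeCompl, IsUnit ((θ : MvPolynomial (Fin 3) K →+* K⟦X⟧) s) := by
    intro s
    rw [isUnit_iff_constantCoeff]
    exact isUnit_iff_ne_zero.2 fun h0 => s.2 ((hmem _).2 ((hev _).symm.trans h0))
  let Θ : R →+* K⟦X⟧ := IsLocalization.lift (M := 𝔭.primeCompl) hunit
  have hΘ : ∀ f, Θ (ι f) = θ f := fun f => IsLocalization.lift_eq hunit f
  let J : Ideal R := (curveIdeal K q n).map ι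
  -- `x ^ q + x = y ^ (q + 1)` and `y ^ (q ^ 2) - y = z ^ r` are étale equations for `x` and `y`,
  -- so `z - P 2` generates the maximal ideal modulo them.
  let x' : R := ι (MvPolynomial.X 0)
  let y' : R := ι (MvPolynomial.X 1)
  let z' : R := ι (MvPolynomial.X 2)
  let c : K → R := fun a => ι (MvPolynomial.C a)
  let π : R := z' - c (P 2)
  have hxyJ : x' ^ q + x' - y' ^ (q + 1) ∈ J := by
    have := Ideal.mem_map_of_mem ι
      (Ideal.subset_span (Set.mem_insert _ _) : MvPolynomial.X 0 ^ q + MvPolynomial.X 0 -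
        MvPolynomial.X 1 ^ (q + 1) ∈ curveIdeal K q n)
    rw [map_sub, map_add, map_pow, map_pow] at this
    exact this
  have hyzJ : y' ^ q ^ 2 - y' - z' ^ exponent q n ∈ J := by
    have := Ideal.mem_map_of_mem ι
      (Ideal.subset_span (Set.mem_insert_of_mem _ rfl) : MvPolynomial.X 1 ^ q ^ 2 -
        MvPolynomial.X 1 - MvPolynomial.X 2 ^ exponent q n ∈ curveIdeal K q n)
    rw [map_sub, map_sub, map_pow, map_pow] at this
    exact this
  have hP1 : P 0 ^ q + P 0 = P 1 ^ (q + 1) := by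
    simpa [hx, hy] using congrArg (constantCoeff (R := K)) hxy
  have hP2 : P 1 ^ q ^ 2 - P 1 = P 2 ^ exponent q n := by
    simpa [hx, hy] using congrArg (constantCoeff (R := K)) hyz
  let M : Ideal R := J ⊔ Ideal.span {π}
  have hπM : π ∈ M := Ideal.mem_sup_right (Ideal.mem_span_singleton_self π)
  have hcoord : ∀ (i : Fin 3) (Q : ℕ) (e : K), (Q : K) = 0 → e ≠ 0 →
      ι (MvPolynomial.X i ^ Q + MvPolynomial.C e * MvPolynomial.X i) -
        c (P i ^ Q + e * P i) ∈ M → ι (MvPolynomial.X i) - c (P i) ∈ M := by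
    intro i Q e hQ he hM
    let G : MvPolynomial (Fin 3) K :=
      ∑ j ∈ Finset.range Q, MvPolynomial.X i ^ j * MvPolynomial.C (P i) ^ (Q - 1 - j)
    have hG : MvPolynomial.eval P (G + MvPolynomial.C e) ≠ 0 := by
      simp [G, geom_sum₂_self, hQ, he]
    have hGm : (G + MvPolynomial.C e) * (MvPolynomial.X i - MvPolynomial.C (P i)) =
        MvPolynomial.X i ^ Q + MvPolynomial.C e * MvPolynomial.X i -
          MvPolynomial.C (P i ^ Q + e * P i) := by
      rw [add_mul, geom_sum₂_mul, map_add, map_pow, map_mul]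
      ring
    rw [← map_sub, ← hGm, map_mul] at hM
    rw [← map_sub]
    exact (Ideal.unit_mul_mem_iff_mem M (hcompl _ hG)).1 hM
  have hyM : y' - c (P 1) ∈ M := by
    refine hcoord 1 (q ^ 2) (-1) (by simp [hq0]) (by simp) ?_
    have h1 : y' ^ q ^ 2 - y' - z' ^ exponent q n ∈ M := Ideal.mem_sup_left hyzJ
    have h2 : z' ^ exponent q n - c (P 2) ^ exponent q n ∈ M :=
      Ideal.mem_of_dvd _ (sub_dvd_pow_sub_pow _ _ _) hπM
    convert M.add_mem h1 h2 using 1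
    simp only [c, ← map_pow ι, ← map_pow MvPolynomial.C, ← hP2]
    simp only [map_add, map_mul, map_pow, map_sub, map_neg, map_one, y', z']
    ring
  have hxM : x' - c (P 0) ∈ M := by
    refine hcoord 0 q 1 hq0 one_ne_zero ?_
    have h1 : x' ^ q + x' - y' ^ (q + 1) ∈ M := Ideal.mem_sup_left hxyJ
    have h2 : y' ^ (q + 1) - c (P 1) ^ (q + 1) ∈ M :=
      Ideal.mem_of_dvd _ (sub_dvd_pow_sub_pow _ _ _) hyM
    convert M.add_mem h1 h2 using 1
    simp only [c, ← map_pow ι, ← map_pow MvPolynomial.C, ← hP1]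
    simp only [map_add, map_mul, map_pow, map_one, x', y']
    ring
  have hmax : IsLocalRing.maximalIdeal R ≤ M := by
    rw [← IsLocalization.AtPrime.map_eq_maximalIdeal 𝔭 R, Ideal.map_le_iff_le_comap]
    intro f hf
    have hmk : (Ideal.Quotient.mk M).comp ι =
        ((Ideal.Quotient.mk M).comp (ι.comp
          MvPolynomial.C)).comp (MvPolynomial.eval P) := by
      refine MvPolynomial.ringHom_ext (fun a => by simp) (fun i => ?_)
      simp only [RingHom.comp_apply, MvPolynomial.eval_X]
      rw [Ideal.Quotient.eq]
      fin_cases i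
      · exact hxM
      · exact hyM
      · exact hπM
    have := RingHom.congr_fun hmk f
    simp only [RingHom.comp_apply, (hmem f).1 hf, map_zero] at this
    exact (Ideal.Quotient.eq_zero_iff_mem (I := M)).1 this
  have hJ : ∀ s ∈ J, Θ s = 0 := by
    have : J ≤ RingHom.ker Θ := by
      refine Ideal.map_le_iff_le_comap.2 (Ideal.span_le.2 ?_)
      rintro f (rfl | rfl) <;>
        simp only [SetLike.mem_coe, Ideal.mem_comap, RingHom.mem_ker, hΘ, map_sub, map_add,
          map_pow, hθ0, hθ1, hθ2, hxy, hyz, sub_self]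
    exact fun s hs => this hs
  have hπX : Θ π = X := by
    simp only [π, z', c, map_sub, hΘ, hθ2, hθC, add_sub_cancel_left]
  have hΘunit : ∀ s, constantCoeff (Θ s) ≠ 0 → IsUnit s := by
    intro s hs
    by_contra hu
    obtain ⟨i, hi, t, ht, rfl⟩ := Submodule.mem_sup.1
      (hmax ((IsLocalRing.mem_maximalIdeal s).2 (mem_nonunits_iff.2 hu)))
    obtain ⟨t, rfl⟩ := Ideal.mem_span_singleton'.1 ht
    simp [hJ i hi, hπX] at hs
  have hsurj : ∀ f : Polynomial K, ∃ s, Θ s = f := by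
    intro f
    refine ⟨ι (Polynomial.aeval (MvPolynomial.X 2 - MvPolynomial.C (P 2)) f), ?_⟩
    rw [hΘ, ← Polynomial.aeval_algHom_apply, map_sub, hθ2, hθC, add_sub_cancel_left, aeval_X_eq_coe]
  have := length_quotient_of_order Θ hΘunit hsurj J hJ π hπX hmax (ι h) μ g hg
    ((hΘ h).trans hh)
  rw [intersectionMultiplicity, Ideal.map_sup, Ideal.map_span, Set.image_singleton]
  exact this

end

/-! ### The polynomial `Z` -/

section

open Polynomial

/-- The hypotheses on the exponents and on the polynomials `F` and `Z`, for `q = p ^ m`, together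
with the arithmetic of `r = (q ^ n + 1) / (q + 1)` that is used. -/
structure IsAdmissible {K : Type*} [Field K] (p m n r : ℕ) (F : MvPolynomial (Fin 2) K)
    (Z : K[X]) : Prop where
  two_le : 2 ≤ p ^ m
  cast_eq_zero : ((p ^ m : ℕ) : K) = 0
  odd : Odd n
  mul_eq : r * (p ^ m + 1) = (p ^ m) ^ n + 1
  F_eq : MvPolynomial.aeval
        ![MvPolynomial.X 0 + MvPolynomial.X 1, MvPolynomial.X 0 * MvPolynomial.X 1] F =
      ((MvPolynomial.X 0 ^ (p ^ m - 1) - 1) * (MvPolynomial.X 1 ^ (p ^ m - 1) - 1) :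
        MvPolynomial (Fin 2) K)
  Z_zero : Z.eval 0 = 0
  Z_eq : X * (Z ^ p ^ m + Z) * MvPolynomial.aeval
      ![X ^ r + (Z ^ p ^ m + Z) + (Z ^ p ^ m + Z) ^ p ^ m, (Z ^ p ^ m + Z) ^ (p ^ m + 1)] F =
    (X ^ r - X) * (X ^ (p ^ m * r) - X)

variable {K : Type*} [Field K] {p m n r : ℕ} {F : MvPolynomial (Fin 2) K} {Z : K[X]}

theorem IsAdmissible.pos (h : IsAdmissible p m n r F Z) : 0 < r := by
  rcases Nat.eq_zero_or_pos r with h0 | h0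
  · have := h.mul_eq
    simp [h0] at this
  · exact h0

theorem IsAdmissible.pow_pos (h : IsAdmissible p m n r F Z) : 0 < (p ^ m) ^ n :=
  Nat.pow_pos (by have := h.two_le; omega)

theorem IsAdmissible.aeval_Z_eq (h : IsAdmissible p m n r F Z) {S : Type*} [CommRing S]
    [Algebra K S] (t s : S) (hs : s = aeval t Z ^ p ^ m + aeval t Z) :
    s * MvPolynomial.aeval ![t ^ r + s + s ^ p ^ m, s ^ (p ^ m + 1)] F =
      (t ^ (r - 1) - 1) * (t ^ (p ^ m * r) - t) := by
  have h1 : (Z ^ p ^ m + Z) * MvPolynomial.aeval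
      ![X ^ r + (Z ^ p ^ m + Z) + (Z ^ p ^ m + Z) ^ p ^ m, (Z ^ p ^ m + Z) ^ (p ^ m + 1)] F =
      (X ^ (r - 1) - 1) * (X ^ (p ^ m * r) - X) := by
    have hX : (X : K[X]) ^ r = X ^ (r - 1) * X := by
      rw [← pow_succ, Nat.sub_add_cancel h.pos]
    refine mul_left_cancel₀ (X_ne_zero (R := K)) ?_
    rw [← mul_assoc, h.Z_eq]
    linear_combination (X ^ (p ^ m * r) - X) * hX
  have h2 := congrArg (aeval t) h1
  rw [map_mul, map_aeval_pair] at h2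
  simpa [hs] using h2

/-- The defining identity of `Z`, evaluated at `t = c z`, against its value at `s = u v`. -/
theorem IsAdmissible.surface_sub_eq [ExpChar K p] (h : IsAdmissible p m n r F Z) {S : Type*}
    [CommRing S] [Algebra K S] [ExpChar S p] {y z b c : S}
    (hyz : y ^ (p ^ m) ^ 2 - y = z ^ r) (hbc : b ^ (p ^ m) ^ 2 - b = c ^ r)
    (s : S) (hs : s = aeval (c * z) Z ^ p ^ m + aeval (c * z) Z) :
    s * MvPolynomial.aeval ![(c * z) ^ r + s + s ^ p ^ m, s ^ (p ^ m + 1)] F -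
      ((y - b ^ p ^ m) ^ (p ^ m) ^ 2 - (y - b ^ p ^ m)) *
        ((y ^ p ^ m - b) ^ (p ^ m) ^ 2 - (y ^ p ^ m - b)) =
      -((z ^ (p ^ m) ^ n - c) * (z - c ^ (p ^ m) ^ n)) := by
  have hpow : ∀ t : S, (t ^ p ^ m) ^ (p ^ m) ^ 2 = (t ^ (p ^ m) ^ 2) ^ p ^ m := fun t =>
    pow_right_comm _ _ _
  have hcb : ∀ s t : S, (s - t) ^ (p ^ m) ^ 2 = s ^ (p ^ m) ^ 2 - t ^ (p ^ m) ^ 2 := fun s t => by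
    rw [← pow_mul, sub_pow_expChar_pow]
  have hy : y ^ (p ^ m) ^ 2 = y + z ^ r := by linear_combination hyz
  have hb : b ^ (p ^ m) ^ 2 = b + c ^ r := by linear_combination hbc
  rw [h.aeval_Z_eq _ s hs, hcb, hcb, hpow, hpow, hy, hb, add_pow_expChar_pow, add_pow_expChar_pow]
  have hN : ∀ t : S, t ^ r * t ^ (p ^ m * r) = t ^ (p ^ m) ^ n * t := fun t => by
    rw [← pow_add, ← pow_succ, ← h.mul_eq]; ring
  have hN' : ∀ t : S, t ^ (r - 1) * t ^ (p ^ m * r) = t ^ (p ^ m) ^ n := fun t => by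
    rw [← pow_add]
    congr 1
    have h1 := h.mul_eq
    have h2 := h.pos
    rw [mul_add, mul_comm r] at h1
    omega
  have hr : (c * z) ^ (r - 1) * (c * z) = c ^ r * z ^ r := by
    rw [← pow_succ, Nat.sub_add_cancel h.pos, mul_pow]
  have hqr : ∀ t : S, (t ^ r) ^ p ^ m = t ^ (p ^ m * r) := fun t => by
    rw [← pow_mul, mul_comm]
  rw [hqr, hqr]
  linear_combination hN' (c * z) - hr - hN z - hN c + mul_pow c z ((p ^ m) ^ n) -
    mul_pow c z (p ^ m * r)

theorem IsAdmissible.prod_dvd [ExpChar K p] (h : IsAdmissible p m n r F Z) {S : Type*}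
    [CommRing S] [Algebra K S] [ExpChar S p] {y z b c : S}
    (hyz : y ^ (p ^ m) ^ 2 - y = z ^ r) (hbc : b ^ (p ^ m) ^ 2 - b = c ^ r)
    (E : Finset K) (hE : ∀ e ∈ E, e ^ (p ^ m) ^ 2 = e) :
    ∏ e ∈ E, (aeval (c * z) Z ^ p ^ m + aeval (c * z) Z -
      (y + algebraMap K S e - b ^ p ^ m) * ((y + algebraMap K S e) ^ p ^ m - b)) ∣
      (z ^ (p ^ m) ^ n - c) * (z - c ^ (p ^ m) ^ n) := by
  have h1 := GKCurve.prod_dvd m h.two_le h.F_eq E hE (y - b ^ p ^ m) (y ^ p ^ m - b)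
    (aeval (c * z) Z ^ p ^ m + aeval (c * z) Z)
  have hk : y ^ p ^ m - b - (y - b ^ p ^ m) ^ p ^ m = c ^ r := by
    rw [sub_pow_expChar_pow, ← hbc]; ring
  have hl : (y ^ p ^ m - b) ^ p ^ m - (y - b ^ p ^ m) = z ^ r := by
    rw [sub_pow_expChar_pow, ← hyz]; ring
  rw [hk, hl, ← mul_pow, h.surface_sub_eq hyz hbc _ rfl, dvd_neg] at h1
  convert h1 using 3 with e he
  rw [add_pow_expChar_pow]
  ring

/-- The polynomial `Σ z ^ (r (q ^ (2 j) + q ^ (2 i + 1)))` over `j ≤ i < l`. For `n = 2 l + 1` it is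
the value of `x + x ^ (q ^ n) - y ^ (q ^ n + 1)` on the curve. -/
noncomputable def pairSum (R : Type*) [CommRing R] (q r l : ℕ) : R[X] :=
  ∑ i ∈ Finset.range l, (∑ j ∈ Finset.range (i + 1), X ^ (r * q ^ (2 * j))) *
    X ^ (r * q ^ (2 * i + 1))

theorem add_pow_eq_pairSum {S : Type*} [CommRing S] [Algebra K S] [ExpChar S p]
    {x y z : S} (hxy : x ^ p ^ m + x = y ^ (p ^ m + 1)) (hyz : y ^ (p ^ m) ^ 2 - y = z ^ r)
    (l : ℕ) :
    x + x ^ (p ^ m) ^ (2 * l + 1) =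
      y ^ ((p ^ m) ^ (2 * l + 1) + 1) + aeval z (pairSum K (p ^ m) r l) := by
  rw [add_pow_eq_sum m hxy l]
  simp [pairSum, hyz, pow_mul]

theorem constantCoeff_aeval (f : K[X]) (s : PowerSeries K) :
    PowerSeries.constantCoeff (aeval s f) = f.eval (PowerSeries.constantCoeff s) := by
  rw [aeval_def, hom_eval₂]
  congr 1

theorem eq_zero_of_pow_add {Q : ℕ} (hQ : 2 ≤ Q) {e : K} (he : e ≠ 0) {s : PowerSeries K}
    (hs : PowerSeries.constantCoeff s = 0) (h : s ^ Q + PowerSeries.C e * s = 0) : s = 0 := by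
  obtain ⟨k, rfl⟩ : ∃ k, Q = k + 2 := ⟨Q - 2, by omega⟩
  have h1 : s * (s ^ (k + 1) + PowerSeries.C e) = 0 := by rw [← h]; ring
  refine (mul_eq_zero.1 h1).resolve_right fun h0 => he ?_
  simpa [hs] using congrArg (PowerSeries.constantCoeff (R := K)) h0

/-- Since `F (0, 0) = 1`, the derivative in `s` of `s F (k + s + s ^ q, s ^ (q + 1))` is a unit at
`k = s = 0`, so a value of this expression determines `s`, as in Hensel's lemma. -/
theorem eq_of_mul_aeval_eq {q : ℕ} (hq : 2 ≤ q)
    (hF : MvPolynomial.aeval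
        ![MvPolynomial.X 0 + MvPolynomial.X 1, MvPolynomial.X 0 * MvPolynomial.X 1] F =
      ((MvPolynomial.X 0 ^ (q - 1) - 1) * (MvPolynomial.X 1 ^ (q - 1) - 1) :
        MvPolynomial (Fin 2) K))
    {k s t : PowerSeries K} (hk : PowerSeries.constantCoeff k = 0)
    (hs : PowerSeries.constantCoeff s = 0) (ht : PowerSeries.constantCoeff t = 0)
    (h : s * MvPolynomial.aeval ![k + s + s ^ q, s ^ (q + 1)] F =
      t * MvPolynomial.aeval ![k + t + t ^ q, t ^ (q + 1)] F) : s = t := by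
  let G : Polynomial (PowerSeries K) :=
    MvPolynomial.aeval ![C k + X + X ^ q, X ^ (q + 1)] F
  have hG : ∀ s : PowerSeries K,
      G.eval s = MvPolynomial.aeval ![k + s + s ^ q, s ^ (q + 1)] F := fun s => by
    have h2 := map_aeval_pair (F := F) ((aeval (R := PowerSeries K) s).restrictScalars K)
      (C k + X + X ^ q) (X ^ (q + 1))
    simp only [AlgHom.restrictScalars_apply, coe_aeval_eq_eval] at h2
    simpa using h2
  let ε : PowerSeries K →ₐ[K] K := AlgHom.mk (PowerSeries.constantCoeff (R := K)) fun a => by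
    simp
  have hε : ∀ s, ε s = PowerSeries.constantCoeff s := fun _ => rfl
  have hGt : PowerSeries.constantCoeff (G.eval t) = 1 := by
    rw [hG, ← hε, map_aeval_pair]
    simp only [map_add, map_pow, hε, hk, ht]
    rw [← aeval_zero_zero hq hF, zero_pow (by omega), zero_pow (by omega), add_zero, add_zero]
  obtain ⟨d, hd⟩ := binomExpansion (X * G) t (s - t)
  rw [add_sub_cancel] at hd
  simp only [eval_mul, eval_X, hG, h, derivative_mul, derivative_X, one_mul, eval_add] at hd
  have hz : (s - t) * (G.eval t + t * (derivative G).eval t + d * (s - t)) = 0 := by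
    rw [hG]; linear_combination -hd
  refine sub_eq_zero.1 ((mul_eq_zero.1 hz).resolve_right fun h0 => ?_)
  simpa [hGt, hs, ht] using congrArg (PowerSeries.constantCoeff (R := K)) h0

/-- The defining identity determines `Z`: on the branch at the origin, with `(a, b, c)` the
`q ^ n`-th power of `(x, y, z)`, it forces `w (z ^ (q ^ n + 1)) = u v`. Hence
`Z (z ^ (q ^ n + 1)) = x + x ^ (q ^ n) - y ^ (q ^ n + 1)`, which telescopes. -/
theorem IsAdmissible.expand_Z [ExpChar K p] {l : ℕ} (h : IsAdmissible p m (2 * l + 1) r F Z) :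
    expand K ((p ^ m) ^ (2 * l + 1) + 1) Z = pairSum K (p ^ m) r l := by
  have : ExpChar (PowerSeries K) p :=
    expChar_of_injective_algebraMap (algebraMap K (PowerSeries K)).injective p
  have hq := h.two_le
  have hr := h.pos
  have hp0 : p ≠ 0 := by
    rintro rfl
    exact absurd hq (by rcases m with _ | m <;> simp)
  obtain ⟨x, y, hx, hy, hxy, hyz⟩ := exists_branch (K := K) (q := p ^ m) (r := r) hq
    h.cast_eq_zero (α := 0) (β := 0) (γ := 0) (by simp [hp0]) (by simp [hp0, hr.ne'])
  rw [map_zero, zero_add] at hyz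
  set z : PowerSeries K := PowerSeries.X with hz
  set N := (p ^ m) ^ (2 * l + 1) with hN
  have hN0 : N ≠ 0 := h.pow_pos.ne'
  have hNp : N = p ^ (m * (2 * l + 1)) := by rw [hN, pow_mul]
  have hab : (x ^ N) ^ p ^ m + x ^ N = (y ^ N) ^ (p ^ m + 1) := by
    rw [pow_right_comm, pow_right_comm y, ← hxy, hNp, add_pow_expChar_pow]
  have hbc : (y ^ N) ^ (p ^ m) ^ 2 - y ^ N = (z ^ N) ^ r := by
    rw [pow_right_comm, pow_right_comm z, ← hyz, hNp, sub_pow_expChar_pow]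
  let s := aeval (z ^ N * z) Z ^ p ^ m + aeval (z ^ N * z) Z
  let u := y - (y ^ N) ^ p ^ m
  let v := y ^ p ^ m - y ^ N
  have hkey := h.surface_sub_eq hyz hbc s rfl
  rw [← hN, sub_self, zero_mul, neg_zero, sub_eq_zero] at hkey
  have hpair := pair_identity (S := PowerSeries K) m hq h.F_eq u v
  have hk : v - u ^ p ^ m = (z ^ N) ^ r := by
    simp only [u, v]
    rw [sub_pow_expChar_pow, ← hbc]; ring
  have hl : v ^ p ^ m - u = z ^ r := by
    simp only [u, v]
    rw [sub_pow_expChar_pow, ← hyz]; ring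
  rw [hk, hl, ← mul_pow] at hpair
  have hZt : PowerSeries.constantCoeff (aeval (z ^ N * z) Z) = 0 := by
    simp [constantCoeff_aeval, hz, h.Z_zero]
  have huv : s = u * v := by
    refine eq_of_mul_aeval_eq (k := (z ^ N * z) ^ r) hq h.F_eq ?_ ?_ ?_ (hkey.trans hpair.symm)
    · simp [hz, hr.ne']
    · simp [s, hZt, hp0]
    · simp [u, hy, hp0, hN0]
  have hD := surface_pow_add_self m hxy hab (aeval (z ^ N * z) Z)
  have hD0 := eq_zero_of_pow_add (s := x + x ^ N - y ^ N * y - aeval (z ^ N * z) Z) hq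
    (e := 1) one_ne_zero (by simp [hx, hy, hZt, hN0]) (by
      rw [map_one, one_mul, hD, sub_eq_zero]
      exact huv.symm)
  have htel := add_pow_eq_pairSum (K := K) hxy hyz l
  apply Polynomial.coe_injective
  rw [← aeval_X_eq_coe, ← aeval_X_eq_coe, expand_aeval, ← hz, pow_succ]
  rw [← hN, pow_succ] at htel
  linear_combination htel - hD0

/-- Every point of the curve lies on its own surface. -/
theorem IsAdmissible.add_pow_eq [ExpChar K p] (h : IsAdmissible p m n r F Z) {S : Type*}
    [CommRing S] [Algebra K S] [ExpChar S p] {x y z : S} (hxy : x ^ p ^ m + x = y ^ (p ^ m + 1))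
    (hyz : y ^ (p ^ m) ^ 2 - y = z ^ r) :
    x + x ^ (p ^ m) ^ n = y ^ ((p ^ m) ^ n + 1) + aeval (z ^ ((p ^ m) ^ n + 1)) Z := by
  obtain ⟨l, rfl⟩ := h.odd
  rw [add_pow_eq_pairSum (K := K) hxy hyz l, ← h.expand_Z, expand_aeval]

/-- `Z` has coefficients in the prime field, so it commutes with the Frobenius map. -/
theorem IsAdmissible.aeval_pow [ExpChar K p] (h : IsAdmissible p m n r F Z) {S : Type*}
    [CommRing S] [Algebra K S] (s : S) (k : ℕ) :
    aeval s Z ^ p ^ k = aeval (s ^ p ^ k) Z := by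
  obtain ⟨l, rfl⟩ := h.odd
  have hmap : Z.map (iterateFrobenius K p k) = Z := by
    refine expand_injective (R := K) (Nat.succ_pos ((p ^ m) ^ (2 * l + 1))) ?_
    rw [← map_expand, h.expand_Z]
    simp [pairSum, Polynomial.map_sum]
  rw [← expand_aeval, ← map_pow, ← map_iterateFrobenius_expand, map_expand, hmap]

end

/-! ### The order of the surface equation along a branch -/

section

open PowerSeries

variable {K : Type*} [Field K] {p m n r : ℕ} {F : MvPolynomial (Fin 2) K} {Z : Polynomial K}

theorem sub_dvd_aeval_sub {S : Type*} [CommRing S] [Algebra K S] (f : Polynomial K) (s t : S) :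
    s - t ∣ Polynomial.aeval s f - Polynomial.aeval t f := by
  rw [← Polynomial.eval_map_algebraMap, ← Polynomial.eval_map_algebraMap]
  exact Polynomial.sub_dvd_eval_sub _ _ _

theorem mul_sub_dvd_aeval_sub {S : Type*} [CommRing S] [Algebra K S] (f : Polynomial K)
    (s t a c : S) :
    (a - c) * (s - t) ∣ Polynomial.aeval (s * a) f - Polynomial.aeval (s * c) f -
      (Polynomial.aeval (t * a) f - Polynomial.aeval (t * c) f) := by
  induction f using Polynomial.induction_on' with
  | add f g hf hg =>
    convert dvd_add hf hg using 1
    simp only [map_add]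
    ring
  | monomial k e =>
    simp only [← Polynomial.C_mul_X_pow_eq_monomial, map_mul, Polynomial.aeval_C, map_pow,
      Polynomial.aeval_X]
    convert Dvd.dvd.mul_left (mul_dvd_mul (sub_dvd_pow_sub_pow a c k) (sub_dvd_pow_sub_pow s t k))
      (algebraMap K S e) using 1
    ring

/-- Subtracting the relation `add_pow_eq` of the running point, the surface equation becomes a
combination of `q ^ n`-th powers of functions vanishing at `P`. -/
theorem IsAdmissible.X_pow_dvd_surface [ExpChar K p] (h : IsAdmissible p m n r F Z) {α β γ : K}
    {x y : K⟦X⟧} (hx : constantCoeff x = α) (hy : constantCoeff y = β)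
    (hxy : x ^ p ^ m + x = y ^ (p ^ m + 1)) (hyz : y ^ (p ^ m) ^ 2 - y = (C γ + X) ^ r) :
    X ^ (p ^ m) ^ n ∣ x + C α ^ (p ^ m) ^ n - C β ^ (p ^ m) ^ n * y -
      Polynomial.aeval (C γ ^ (p ^ m) ^ n * (C γ + X)) Z := by
  have : ExpChar K⟦X⟧ p := expChar_of_injective_algebraMap (algebraMap K K⟦X⟧).injective p
  have hadd := h.add_pow_eq hxy hyz
  have hsub : ∀ s t : K⟦X⟧, (s - t) ^ (p ^ m) ^ n = s ^ (p ^ m) ^ n - t ^ (p ^ m) ^ n :=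
    fun s t => by rw [← pow_mul, sub_pow_expChar_pow]
  have h1 : X ^ (p ^ m) ^ n ∣ x ^ (p ^ m) ^ n - C α ^ (p ^ m) ^ n := by
    rw [← hsub]; exact pow_dvd_pow_of_dvd (X_dvd_iff.2 (by simp [hx])) _
  have h2 : X ^ (p ^ m) ^ n ∣ y ^ (p ^ m) ^ n - C β ^ (p ^ m) ^ n := by
    rw [← hsub]; exact pow_dvd_pow_of_dvd (X_dvd_iff.2 (by simp [hy])) _
  have h3 : X ^ (p ^ m) ^ n ∣ Polynomial.aeval ((C γ + X) ^ ((p ^ m) ^ n + 1)) Z -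
      Polynomial.aeval (C γ ^ (p ^ m) ^ n * (C γ + X)) Z := by
    refine Dvd.dvd.trans ?_ (sub_dvd_aeval_sub _ _ _)
    rw [pow_succ, ← sub_mul, ← hsub, add_sub_cancel_left]
    exact dvd_mul_right _ _
  convert dvd_add (dvd_sub (dvd_mul_of_dvd_right h2 y) h1) h3 using 1
  linear_combination hadd

/-- At a point `P` fixed by `Φ` the surface equation `g` vanishes to one order more. Write `N` for
`q ^ n`. With `Z (s) ^ N = Z (s ^ N)`, the expression for `g` as a sum of multiples of `N`-th
powers agrees, up to order `N + 1`, with `g ^ (N ^ 2)`, which has order at least `N + 1`. -/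
theorem IsAdmissible.X_pow_succ_dvd_surface [ExpChar K p] (h : IsAdmissible p m n r F Z)
    {α β γ : K} {x y : K⟦X⟧} (hx : constantCoeff x = α) (hy : constantCoeff y = β)
    (hxy : x ^ p ^ m + x = y ^ (p ^ m + 1)) (hyz : y ^ (p ^ m) ^ 2 - y = (C γ + X) ^ r)
    (hα : (α ^ (p ^ m) ^ n) ^ (p ^ m) ^ n = α) (hβ : (β ^ (p ^ m) ^ n) ^ (p ^ m) ^ n = β)
    (hγ : (γ ^ (p ^ m) ^ n) ^ (p ^ m) ^ n = γ) :
    X ^ ((p ^ m) ^ n + 1) ∣ x + C α ^ (p ^ m) ^ n - C β ^ (p ^ m) ^ n * y -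
      Polynomial.aeval (C γ ^ (p ^ m) ^ n * (C γ + X)) Z := by
  have : ExpChar K⟦X⟧ p := expChar_of_injective_algebraMap (algebraMap K K⟦X⟧).injective p
  have hadd := h.add_pow_eq hxy hyz
  have hg := h.X_pow_dvd_surface hx hy hxy hyz
  set N := (p ^ m) ^ n with hN
  have hN2 : 2 ≤ N := by
    obtain ⟨l, rfl⟩ := h.odd
    exact h.two_le.trans (Nat.le_self_pow (by omega) _)
  have hNp : N = p ^ (m * n) := by rw [hN, pow_mul]
  have hsub : ∀ s t : K⟦X⟧, (s - t) ^ N = s ^ N - t ^ N :=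
    fun s t => by rw [hNp, sub_pow_expChar_pow]
  have hadd' : ∀ s t : K⟦X⟧, (s + t) ^ N = s ^ N + t ^ N :=
    fun s t => by rw [hNp, add_pow_expChar_pow]
  have hZ : ∀ s : K⟦X⟧, Polynomial.aeval s Z ^ N = Polynomial.aeval (s ^ N) Z :=
    fun s => by rw [hNp, h.aeval_pow]
  set z : K⟦X⟧ := C γ + X with hz
  set g := x + C α ^ N - C β ^ N * y - Polynomial.aeval (C γ ^ N * z) Z with hgdef
  have hα' : (C α ^ N : K⟦X⟧) ^ N = C α := by rw [← map_pow, ← map_pow, hα]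
  have hβ' : (C β ^ N : K⟦X⟧) ^ N = C β := by rw [← map_pow, ← map_pow, hβ]
  have hγ' : (C γ ^ N : K⟦X⟧) ^ N = C γ := by rw [← map_pow, ← map_pow, hγ]
  have hg1 : g ^ N = C α - x + y ^ N * (y - C β) + (Polynomial.aeval (z ^ (N + 1)) Z -
      Polynomial.aeval (C γ * z ^ N) Z) := by
    rw [hgdef, hsub, hsub, hadd', mul_pow, hZ, mul_pow, hα', hβ', hγ']
    linear_combination hadd
  have hg2 : (g ^ N) ^ N = C α ^ N - x ^ N + (y ^ N) ^ N * (y - C β) ^ N +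
      (Polynomial.aeval ((z ^ N) ^ N * z ^ N) Z - Polynomial.aeval ((z ^ N) ^ N * C γ ^ N) Z) := by
    rw [hg1, hadd', hadd', hsub, hsub, mul_pow, hZ, hZ, pow_succ, mul_pow, mul_pow,
      mul_comm (C γ ^ N)]
  have hg3 : g = (g ^ N) ^ N + (y - (y ^ N) ^ N) * (y - C β) ^ N +
      (Polynomial.aeval (z * z ^ N) Z - Polynomial.aeval (z * C γ ^ N) Z -
      (Polynomial.aeval ((z ^ N) ^ N * z ^ N) Z -
        Polynomial.aeval ((z ^ N) ^ N * C γ ^ N) Z)) := by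
    rw [hg2, hgdef, hsub y, ← pow_succ' z N, mul_comm z]
    linear_combination hadd
  have hzN : z ^ N - C γ ^ N = X ^ N := by rw [← hsub, hz, add_sub_cancel_left]
  rw [hg3]
  refine dvd_add (dvd_add ?_ ?_) ?_
  · rw [← pow_mul]
    refine dvd_trans ?_ (pow_dvd_pow_of_dvd hg _)
    rw [← pow_mul]
    exact pow_dvd_pow _ (by nlinarith)
  · rw [pow_succ']
    refine mul_dvd_mul (X_dvd_iff.2 (by simp [hy, hβ])) (pow_dvd_pow_of_dvd ?_ _)
    exact X_dvd_iff.2 (by simp [hy])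
  · refine dvd_trans ?_ (mul_sub_dvd_aeval_sub Z z ((z ^ N) ^ N) (z ^ N) (C γ ^ N))
    rw [hzN, pow_succ]
    refine mul_dvd_mul_left _ (X_dvd_iff.2 ?_)
    simp [hz, hγ]

end

/-! ### Counting along the fibres of `z` -/

section

open PowerSeries

variable {K : Type*} [Field K] {p m n : ℕ} {F : MvPolynomial (Fin 2) K} {Z : Polynomial K}

theorem mem_curve_iff {q : ℕ} {Q : Fin 3 → K} : Q ∈ curve K q n ↔
    Q 0 ^ q + Q 0 = Q 1 ^ (q + 1) ∧ Q 1 ^ q ^ 2 - Q 1 = Q 2 ^ exponent q n := by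
  simp [curve, curveIdeal, MvPolynomial.zeroLocus_span, sub_eq_zero]

theorem aeval_surface {S : Type*} [CommRing S] [Algebra K S] (Z : Polynomial K) (a b c : K)
    (s : Fin 3 → S) : MvPolynomial.aeval s (surface Z a b c) =
      s 0 + algebraMap K S a - algebraMap K S b * s 1 -
        Polynomial.aeval (algebraMap K S c * s 2) Z := by
  simp [surface, ← Polynomial.aeval_algHom_apply]

theorem eval_surface (Z : Polynomial K) (a b c : K) (Q : Fin 3 → K) :
    MvPolynomial.eval Q (surface Z a b c) = Q 0 + a - b * Q 1 - Polynomial.eval (c * Q 2) Z := by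
  simpa [Polynomial.coe_aeval_eq_eval, MvPolynomial.aeval_eq_eval] using aeval_surface Z a b c Q

/-- The points of the curve on the surface with parameters `P ^ (q ^ n)`. -/
def surfacePoints (Z : Polynomial K) (q n : ℕ) (P : Fin 3 → K) : Set (Fin 3 → K) :=
  {Q | Q ∈ curve K q n ∧
    MvPolynomial.eval Q (surface Z (P 0 ^ q ^ n) (P 1 ^ q ^ n) (P 2 ^ q ^ n)) = 0}

theorem IsAdmissible.prod_dvd_powerSeries [ExpChar K p]
    (h : IsAdmissible p m n (exponent (p ^ m) n) F Z) {P : Fin 3 → K} (hP : P ∈ curve K (p ^ m) n)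
    {z₀ : K} {y : K⟦X⟧} (hyz : y ^ (p ^ m) ^ 2 - y = (C z₀ + X) ^ exponent (p ^ m) n)
    (E : Finset K) (hE : ∀ e ∈ E, e ^ (p ^ m) ^ 2 = e) :
    ∏ e ∈ E, (Polynomial.aeval (C (P 2) ^ (p ^ m) ^ n * (C z₀ + X)) Z ^ p ^ m +
        Polynomial.aeval (C (P 2) ^ (p ^ m) ^ n * (C z₀ + X)) Z -
      (y + C e - (C (P 1) ^ (p ^ m) ^ n) ^ p ^ m) *
        ((y + C e) ^ p ^ m - C (P 1) ^ (p ^ m) ^ n)) ∣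
      (C (z₀ - P 2) + X) ^ (p ^ m) ^ n * (C (z₀ - (P 2 ^ (p ^ m) ^ n) ^ (p ^ m) ^ n) + X) := by
  have : ExpChar K⟦X⟧ p := expChar_of_injective_algebraMap (algebraMap K K⟦X⟧).injective p
  have hbc : (C (P 1) ^ (p ^ m) ^ n : K⟦X⟧) ^ (p ^ m) ^ 2 - C (P 1) ^ (p ^ m) ^ n =
      (C (P 2) ^ (p ^ m) ^ n) ^ exponent (p ^ m) n := by
    rw [pow_right_comm, ← pow_mul p m n, ← sub_pow_expChar_pow, ← map_pow, ← map_sub,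
      (mem_curve_iff.1 hP).2, pow_right_comm, ← map_pow C (P 2) (exponent _ _)]
  have hN : (C (z₀ - P 2) + X : K⟦X⟧) ^ (p ^ m) ^ n =
      (C z₀ + X) ^ (p ^ m) ^ n - C (P 2) ^ (p ^ m) ^ n := by
    rw [map_sub, sub_add_eq_add_sub, ← pow_mul, sub_pow_expChar_pow]
  rw [hN, map_sub, map_pow, map_pow, sub_add_eq_add_sub]
  exact h.prod_dvd hyz hbc E hE

/-- The multiplicity at `Q` is finite and bounds from below the order at `Q` of `w (c z) - u v`,
for every choice of a branch `y`. At `Q = P` it is at least `q ^ n`, and at least `q ^ n + 1` if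
`P` is fixed by `Φ`. -/
theorem IsAdmissible.exists_multiplicity [ExpChar K p]
    (h : IsAdmissible p m n (exponent (p ^ m) n) F Z) {P Q : Fin 3 → K}
    (hP : P ∈ curve K (p ^ m) n) (hQ : Q ∈ surfacePoints Z (p ^ m) n P) :
    ∃ μ : ℕ, 1 ≤ μ ∧
      intersectionMultiplicity (curveIdeal K (p ^ m) n)
        (surface Z (P 0 ^ (p ^ m) ^ n) (P 1 ^ (p ^ m) ^ n) (P 2 ^ (p ^ m) ^ n)) Q = μ ∧
      (∀ y : K⟦X⟧, constantCoeff y = Q 1 →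
        y ^ (p ^ m) ^ 2 - y = (C (Q 2) + X) ^ exponent (p ^ m) n →
        X ^ μ ∣ Polynomial.aeval (C (P 2) ^ (p ^ m) ^ n * (C (Q 2) + X)) Z ^ p ^ m +
            Polynomial.aeval (C (P 2) ^ (p ^ m) ^ n * (C (Q 2) + X)) Z -
          (y - (C (P 1) ^ (p ^ m) ^ n) ^ p ^ m) * (y ^ p ^ m - C (P 1) ^ (p ^ m) ^ n)) ∧
      (Q = P → (p ^ m) ^ n ≤ μ) ∧
      (Q = P → (∀ i, (P i ^ (p ^ m) ^ n) ^ (p ^ m) ^ n = P i) → (p ^ m) ^ n + 1 ≤ μ) := by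
  have : ExpChar K⟦X⟧ p := expChar_of_injective_algebraMap (algebraMap K K⟦X⟧).injective p
  have hQC := mem_curve_iff.1 hQ.1
  have hPC := mem_curve_iff.1 hP
  set N := (p ^ m) ^ n with hN
  have hNp : N = p ^ (m * n) := by rw [hN, pow_mul]
  set f := surface Z (P 0 ^ N) (P 1 ^ N) (P 2 ^ N) with hf
  -- The order of `f` on a branch at `Q` is the multiplicity.
  have hbranch : ∀ x y : K⟦X⟧, constantCoeff x = Q 0 → constantCoeff y = Q 1 →
      x ^ p ^ m + x = y ^ (p ^ m + 1) →
      y ^ (p ^ m) ^ 2 - y = (C (Q 2) + X) ^ exponent (p ^ m) n →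
      ∃ μ : ℕ, intersectionMultiplicity (curveIdeal K (p ^ m) n) f Q = μ ∧
        (∀ k, X ^ k ∣ x + C (P 0) ^ N - C (P 1) ^ N * y -
          Polynomial.aeval (C (P 2) ^ N * (C (Q 2) + X)) Z → k ≤ μ) ∧
        X ^ μ ∣ Polynomial.aeval (C (P 2) ^ N * (C (Q 2) + X)) Z ^ p ^ m +
            Polynomial.aeval (C (P 2) ^ N * (C (Q 2) + X)) Z -
          (y - (C (P 1) ^ N) ^ p ^ m) * (y ^ p ^ m - C (P 1) ^ N) := by
    intro x y hx hy hxy hyz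
    set g := x + C (P 0) ^ N - C (P 1) ^ N * y -
      Polynomial.aeval (C (P 2) ^ N * (C (Q 2) + X)) Z with hg
    have hab : (C (P 0) ^ N : K⟦X⟧) ^ p ^ m + C (P 0) ^ N = (C (P 1) ^ N) ^ (p ^ m + 1) := by
      rw [pow_right_comm, hNp, ← add_pow_expChar_pow, ← map_pow, ← map_add, hPC.1, map_pow,
        pow_right_comm]
    have hgΨ := surface_pow_add_self m hxy hab
      (Polynomial.aeval (C (P 2) ^ N * (C (Q 2) + X)) Z)
    rw [← hg] at hgΨ
    have hdvd : ∀ s, s ∣ g → s ∣ Polynomial.aeval (C (P 2) ^ N * (C (Q 2) + X)) Z ^ p ^ m +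
            Polynomial.aeval (C (P 2) ^ N * (C (Q 2) + X)) Z -
          (y - (C (P 1) ^ N) ^ p ^ m) * (y ^ p ^ m - C (P 1) ^ N) := by
      intro s hs
      rw [← dvd_neg, neg_sub, ← hgΨ]
      exact dvd_add (dvd_pow hs (by have := h.two_le; omega)) hs
    have hlin : ∀ a : K, C a + X ≠ (0 : K⟦X⟧) := fun a h0 => by
      simpa [coeff_C] using congrArg (coeff (R := K) 1) h0
    have hg0 : g ≠ 0 := by
      intro h0
      have h1 := h.prod_dvd_powerSeries hP hyz {0} (by
        have := h.two_le
        simp only [Finset.mem_singleton, forall_eq]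
        exact zero_pow (by positivity))
      rw [Finset.prod_singleton, map_zero, add_zero] at h1
      have h2 := (hdvd 0 (by rw [h0])).trans h1
      exact mul_ne_zero (pow_ne_zero _ (hlin _)) (hlin _) (zero_dvd_iff.1 h2)
    obtain ⟨μ, k, hk, hgk⟩ := WfDvdMonoid.max_power_factor hg0 (X_irreducible (R := K))
    refine ⟨μ, ?_, fun j hj => ?_, hdvd _ (hgk ▸ dvd_mul_right _ _)⟩
    · refine intersectionMultiplicity_eq_of_branch h.cast_eq_zero hx hy hxy hyz f μ k
        (fun h0 => hk (X_dvd_iff.2 h0)) ?_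
      rw [← hgk, hf, aeval_surface, hg]
      simp
    · by_contra hlt
      rw [hgk] at hj
      refine hk ((mul_dvd_mul_iff_left (pow_ne_zero μ X_ne_zero)).1 (dvd_trans ?_ hj))
      rw [← pow_succ]
      exact pow_dvd_pow _ (by omega)
  obtain ⟨x, y, hx, hy, hxy, hyz⟩ := exists_branch h.two_le h.cast_eq_zero hQC.1 hQC.2
  obtain ⟨μ, hμ, hle, -⟩ := hbranch x y hx hy hxy hyz
  refine ⟨μ, hle 1 ?_, hμ, fun y' hy' hyz' => ?_, ?_, ?_⟩
  · rw [pow_one, X_dvd_iff]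
    have := hQ.2
    rw [eval_surface] at this
    simpa [constantCoeff_aeval, hx, hy] using this
  · obtain ⟨x', hx', hxy'⟩ := exists_root_add_mul h.two_le h.cast_eq_zero (e := 1) one_ne_zero
      (y' ^ (p ^ m + 1)) (α := Q 0) (by simp [hy', hQC.1])
    obtain ⟨μ', hμ', -, hd⟩ := hbranch x' y' hx' hy' (by simpa using hxy') hyz'
    have : μ = μ' := by exact_mod_cast hμ.symm.trans hμ'
    rwa [this]
  · rintro rfl
    exact hle _ (h.X_pow_dvd_surface hx hy hxy hyz)
  · rintro rfl hfix
    exact hle _ (h.X_pow_succ_dvd_surface hx hy hxy hyz (hfix 0) (hfix 1) (hfix 2))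

/-- The multiplicities of points over the same value of `z` add up to at most the order of
`(z ^ N - c) (z - c ^ N)`, where `N = q ^ n`. -/
theorem IsAdmissible.X_pow_sum_dvd [ExpChar K p]
    (h : IsAdmissible p m n (exponent (p ^ m) n) F Z) {P : Fin 3 → K}
    (hP : P ∈ curve K (p ^ m) n) (μ : (Fin 3 → K) → ℕ)
    (hμ : ∀ Q ∈ surfacePoints Z (p ^ m) n P, intersectionMultiplicity (curveIdeal K (p ^ m) n)
        (surface Z (P 0 ^ (p ^ m) ^ n) (P 1 ^ (p ^ m) ^ n) (P 2 ^ (p ^ m) ^ n)) Q = μ Q)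
    (z₀ : K) (s : Finset (Fin 3 → K)) (hs : ∀ Q ∈ s, Q ∈ surfacePoints Z (p ^ m) n P)
    (hz : ∀ Q ∈ s, Q 2 = z₀) :
    (X : K⟦X⟧) ^ (∑ Q ∈ s, μ Q) ∣
      (C (z₀ - P 2) + X) ^ (p ^ m) ^ n * (C (z₀ - (P 2 ^ (p ^ m) ^ n) ^ (p ^ m) ^ n) + X) := by
  classical
  have : ExpChar K⟦X⟧ p := expChar_of_injective_algebraMap (algebraMap K K⟦X⟧).injective p
  rcases s.eq_empty_or_nonempty with rfl | ⟨Q₀, hQ₀⟩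
  · simp
  have hQ₀C := mem_curve_iff.1 (hs Q₀ hQ₀).1
  obtain ⟨x, y, hx, hy, hxy, hyz⟩ := exists_branch h.two_le h.cast_eq_zero hQ₀C.1 hQ₀C.2
  rw [hz Q₀ hQ₀] at hyz
  have hE : ∀ Q ∈ s, (Q 1 - Q₀ 1) ^ (p ^ m) ^ 2 = Q 1 - Q₀ 1 := by
    intro Q hQ
    have h1 := (mem_curve_iff.1 (hs Q hQ).1).2
    have h2 := hQ₀C.2
    rw [hz Q hQ] at h1
    rw [hz Q₀ hQ₀] at h2
    rw [← pow_mul, sub_pow_expChar_pow, pow_mul]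
    linear_combination h1 - h2
  have hinj : Set.InjOn (fun Q : Fin 3 → K => Q 1 - Q₀ 1) s := by
    intro Q hQ Q' hQ' he
    have h1 : Q 1 = Q' 1 := sub_left_injective he
    have h2 : Q 2 = Q' 2 := (hz Q hQ).trans (hz Q' hQ').symm
    have h3 := (hs Q hQ).2
    have h4 := (hs Q' hQ').2
    rw [eval_surface, h1, h2] at h3
    rw [eval_surface] at h4
    ext i
    fin_cases i
    · change Q 0 = Q' 0
      linear_combination h3 - h4
    · exact h1
    · exact h2
  have hprod := h.prod_dvd_powerSeries hP hyz (s.image fun Q => Q 1 - Q₀ 1) (by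
    intro e he
    obtain ⟨Q, hQ, rfl⟩ := Finset.mem_image.1 he
    exact hE Q hQ)
  rw [Finset.prod_image hinj] at hprod
  refine dvd_trans ?_ hprod
  rw [← Finset.prod_pow_eq_pow_sum]
  refine Finset.prod_dvd_prod_of_dvd _ _ fun Q hQ => ?_
  obtain ⟨μ', -, hμ', hd, -⟩ := h.exists_multiplicity hP (hs Q hQ)
  have : μ Q = μ' := by exact_mod_cast (hμ Q (hs Q hQ)).symm.trans hμ'
  rw [this, ← hz Q hQ]
  refine hd _ (by simp [hy]) ?_
  rw [hz Q hQ, ← hyz, ← pow_mul, add_pow_expChar_pow, pow_mul, ← map_pow, hE Q hQ]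
  ring

end

/-! ### The intersection -/

section

open PowerSeries

variable {K : Type*} [Field K] {p m n : ℕ} {F : MvPolynomial (Fin 2) K} {Z : Polynomial K}

theorem powPoint_mem_curve [ExpChar K p] {Q : Fin 3 → K} (hQ : Q ∈ curve K (p ^ m) n) (k : ℕ) :
    powPoint (p ^ k) Q ∈ curve K (p ^ m) n := by
  rw [mem_curve_iff] at hQ ⊢
  simp only [powPoint]
  constructor
  · rw [pow_right_comm, ← add_pow_expChar_pow, hQ.1, pow_right_comm]
  · rw [pow_right_comm, ← sub_pow_expChar_pow, hQ.2, pow_right_comm]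

theorem IsAdmissible.self_mem_surfacePoints [ExpChar K p]
    (h : IsAdmissible p m n (exponent (p ^ m) n) F Z) {P : Fin 3 → K}
    (hP : P ∈ curve K (p ^ m) n) : P ∈ surfacePoints Z (p ^ m) n P := by
  refine ⟨hP, ?_⟩
  have h1 := mem_curve_iff.1 hP
  have h2 := h.add_pow_eq h1.1 h1.2
  rw [Polynomial.coe_aeval_eq_eval, pow_succ, pow_succ] at h2
  rw [eval_surface]
  linear_combination h2

theorem IsAdmissible.frobenius_mem_surfacePoints [ExpChar K p]
    (h : IsAdmissible p m n (exponent (p ^ m) n) F Z) {P : Fin 3 → K}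
    (hP : P ∈ curve K (p ^ m) n) :
    powPoint ((p ^ m) ^ (2 * n)) P ∈ surfacePoints Z (p ^ m) n P := by
  refine ⟨pow_mul p m (2 * n) ▸ powPoint_mem_curve hP _, ?_⟩
  have h1 := mem_curve_iff.1 (powPoint_mem_curve hP (m * n))
  have h2 := h.add_pow_eq h1.1 h1.2
  have hsq : ∀ i, P i ^ (p ^ m) ^ (2 * n) = (P i ^ (p ^ m) ^ n) ^ (p ^ m) ^ n := fun i => by
    rw [two_mul, pow_add, pow_mul]
  simp only [powPoint, pow_mul p m n, Polynomial.coe_aeval_eq_eval, pow_succ _ ((p ^ m) ^ n)] at h2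
  rw [eval_surface]
  simp only [powPoint, hsq, mul_comm (P 2 ^ (p ^ m) ^ n)]
  linear_combination h2

/-- By `X_pow_sum_dvd`, the multiplicities over a fixed `z` sum to at most the order of
`(z ^ N - c) (z - c ^ N)`, with `N = q ^ n`; by `exists_multiplicity`, the points `P` and `Φ(P)`
already use up this order, which leaves room neither for larger multiplicities nor for further
points. -/
theorem IsAdmissible.surfacePoints_and_multiplicities [ExpChar K p]
    (h : IsAdmissible p m n (exponent (p ^ m) n) F Z) {P ΦP : Fin 3 → K}
    (hP : P ∈ curve K (p ^ m) n) (hΦP : ΦP = powPoint ((p ^ m) ^ (2 * n)) P) :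
    surfacePoints Z (p ^ m) n P = {P, ΦP} ∧
    (P ≠ ΦP →
      intersectionMultiplicity (curveIdeal K (p ^ m) n)
        (surface Z (P 0 ^ (p ^ m) ^ n) (P 1 ^ (p ^ m) ^ n) (P 2 ^ (p ^ m) ^ n)) P =
          ((p ^ m) ^ n : ℕ) ∧
      intersectionMultiplicity (curveIdeal K (p ^ m) n)
        (surface Z (P 0 ^ (p ^ m) ^ n) (P 1 ^ (p ^ m) ^ n) (P 2 ^ (p ^ m) ^ n)) ΦP = 1) ∧
    (P = ΦP →
      intersectionMultiplicity (curveIdeal K (p ^ m) n)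
        (surface Z (P 0 ^ (p ^ m) ^ n) (P 1 ^ (p ^ m) ^ n) (P 2 ^ (p ^ m) ^ n)) P =
          ((p ^ m) ^ n + 1 : ℕ)) := by
  classical
  have hPS := h.self_mem_surfacePoints hP
  have hΦS : ΦP ∈ surfacePoints Z (p ^ m) n P := hΦP ▸ h.frobenius_mem_surfacePoints hP
  have hΦi : ∀ i, ΦP i = (P i ^ (p ^ m) ^ n) ^ (p ^ m) ^ n := fun i => by
    rw [hΦP, powPoint, two_mul, pow_add, pow_mul]
  choose! μ hμ1 hμ hd hμP hμΦ using fun Q (hQ : Q ∈ surfacePoints Z (p ^ m) n P) =>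
    h.exists_multiplicity hP hQ
  have hsum := h.X_pow_sum_dvd hP μ hμ
  simp only [← hΦi] at hsum
  set N := (p ^ m) ^ n
  have hNP := hμP P hPS rfl
  have hunit : ∀ a : K, a ≠ 0 → IsUnit (C a + X : K⟦X⟧) := fun a ha => by
    rw [isUnit_iff_constantCoeff]
    simpa using ha
  have hle : ∀ j k : ℕ, (X : K⟦X⟧) ^ j ∣ X ^ k → j ≤ k := fun j k hjk =>
    (pow_dvd_pow_iff X_ne_zero X_prime.not_isUnit).1 hjk
  have hzero : ∀ Q ∈ surfacePoints Z (p ^ m) n P, Q 2 = P 2 ∨ Q 2 = ΦP 2 := by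
    intro Q hQ
    by_contra! hne
    have h1 := hsum (Q 2) {Q} (by simpa using hQ) (by simp)
    have h2 := ((hunit _ (sub_ne_zero.2 hne.1)).pow N).mul (hunit _ (sub_ne_zero.2 hne.2))
    rw [Finset.sum_singleton] at h1
    have h3 := hle (μ Q) 0 (by simpa using h1.trans h2.dvd)
    have := hμ1 Q hQ
    omega
  suffices hs : (∀ Q ∈ surfacePoints Z (p ^ m) n P, Q = P ∨ Q = ΦP) ∧
      (P ≠ ΦP → μ P = N ∧ μ ΦP = 1) ∧ (P = ΦP → μ P = N + 1) by
    refine ⟨Set.ext fun Q => ⟨hs.1 Q, ?_⟩, fun hne => ?_, fun he => ?_⟩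
    · rintro (rfl | rfl)
      exacts [hPS, hΦS]
    · rw [hμ P hPS, hμ ΦP hΦS, (hs.2.1 hne).1, (hs.2.1 hne).2]
      exact ⟨rfl, Nat.cast_one⟩
    · rw [hμ P hPS, hs.2.2 he]
  by_cases hz : P 2 = ΦP 2
  · -- All points of the intersection lie over the same value of `z`.
    have hbound : ∀ s : Finset (Fin 3 → K), (∀ Q ∈ s, Q ∈ surfacePoints Z (p ^ m) n P) →
        ∑ Q ∈ s, μ Q ≤ N + 1 := by
      intro s hs
      have h1 := hsum (P 2) s hs fun Q hQ => (hzero Q (hs Q hQ)).elim id fun e => e.trans hz.symm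
      rw [← hz] at h1
      simp only [sub_self, map_zero, zero_add, ← pow_succ] at h1
      exact hle _ _ h1
    by_cases he : P = ΦP
    · have hN1 := hμΦ P hPS rfl fun i => (hΦi i).symm.trans (congrFun he i).symm
      refine ⟨fun Q hQ => ?_, fun hne => absurd he hne, fun _ => ?_⟩
      · by_contra! hQP
        have h1 := hbound {P, Q} (by simp [hPS, hQ])
        rw [Finset.sum_pair hQP.1.symm] at h1
        have := hμ1 Q hQ
        omega
      · have h1 := hbound {P} (by simp [hPS])
        rw [Finset.sum_singleton] at h1
        omega
    · have h1 := hbound {P, ΦP} (by simp [hPS, hΦS])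
      rw [Finset.sum_pair he] at h1
      have hΦ1 := hμ1 ΦP hΦS
      refine ⟨fun Q hQ => ?_, fun _ => by omega, fun e => absurd e he⟩
      by_contra! hQ'
      have h2 := hbound {Q, P, ΦP} (by simp [hPS, hΦS, hQ])
      rw [Finset.sum_insert (by simp [hQ'.1, hQ'.2]), Finset.sum_pair he] at h2
      have := hμ1 Q hQ
      omega
  · have he : P ≠ ΦP := fun e => hz (congrFun e 2)
    have hboundP : ∀ s : Finset (Fin 3 → K), (∀ Q ∈ s, Q ∈ surfacePoints Z (p ^ m) n P) →
        (∀ Q ∈ s, Q 2 = P 2) → ∑ Q ∈ s, μ Q ≤ N := by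
      intro s hs hs2
      have h1 := hsum (P 2) s hs hs2
      rw [sub_self, map_zero, zero_add, (hunit _ (sub_ne_zero.2 hz)).dvd_mul_right] at h1
      exact hle _ _ h1
    have hboundΦ : ∀ s : Finset (Fin 3 → K), (∀ Q ∈ s, Q ∈ surfacePoints Z (p ^ m) n P) →
        (∀ Q ∈ s, Q 2 = ΦP 2) → ∑ Q ∈ s, μ Q ≤ 1 := by
      intro s hs hs2
      have h1 := hsum (ΦP 2) s hs hs2
      rw [sub_self, map_zero, zero_add,
        ((hunit _ (sub_ne_zero.2 (Ne.symm hz))).pow N).dvd_mul_left] at h1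
      exact hle _ 1 (by rwa [pow_one])
    have h1 := hboundP {P} (by simp [hPS]) (by simp)
    have h2 := hboundΦ {ΦP} (by simp [hΦS]) (by simp)
    rw [Finset.sum_singleton] at h1 h2
    have hΦ1 := hμ1 ΦP hΦS
    refine ⟨fun Q hQ => ?_, fun _ => by omega, fun e => absurd e he⟩
    by_contra! hQ'
    have hQ1 := hμ1 Q hQ
    rcases hzero Q hQ with hQz | hQz
    · have h3 := hboundP {Q, P} (by simp [hPS, hQ]) (by simp [hQz])
      rw [Finset.sum_pair hQ'.1] at h3
      omega
    · have h3 := hboundΦ {Q, ΦP} (by simp [hΦS, hQ]) (by simp [hQz])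
      rw [Finset.sum_pair hQ'.2] at h3
      omega

end

end GKCurve

theorem theorem1 {K : Type*} [Field K] [IsAlgClosed K] (p m n : ℕ) (hp : p.Prime) [CharP K p]
    (hm : 1 ≤ m) (hn : Odd n) (q r : ℕ) (hq : q = p ^ m) (hr : r = GKCurve.exponent q n)
    -- `F` is the polynomial with `F(X + Y, XY) = (X ^ (q - 1) - 1) (Y ^ (q - 1) - 1)`
    (F : MvPolynomial (Fin 2) K)
    (hF : MvPolynomial.aeval
        ![MvPolynomial.X 0 + MvPolynomial.X 1, MvPolynomial.X 0 * MvPolynomial.X 1] F =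
      ((MvPolynomial.X 0 ^ (q - 1) - 1) * (MvPolynomial.X 1 ^ (q - 1) - 1) :
        MvPolynomial (Fin 2) K))
    -- `Z` is a polynomial in `t` without constant term, and `w = Z ^ q + Z`
    (Z w t : Polynomial K) (ht : t = Polynomial.X) (hw : w = Z ^ q + Z) (hZ0 : Z.eval 0 = 0)
    (hZ : t * w * MvPolynomial.aeval ![t ^ r + w + w ^ q, w ^ (q + 1)] F =
      (t ^ r - t) * (t ^ (q * r) - t))
    (α β γ a b c : K) (P ΦP : Fin 3 → K) (hP : P = ![α, β, γ]) (hPC : P ∈ GKCurve.curve K q n)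
    (hΦP : ΦP = GKCurve.powPoint (q ^ (2 * n)) P)
    (ha : a = α ^ q ^ n) (hb : b = β ^ q ^ n) (hc : c = γ ^ q ^ n) :
    {Q | Q ∈ GKCurve.curve K q n ∧ MvPolynomial.eval Q (GKCurve.surface Z a b c) = 0} = {P, ΦP} ∧
    (P ≠ ΦP →
      GKCurve.intersectionMultiplicity (GKCurve.curveIdeal K q n)
        (GKCurve.surface Z a b c) P = (q ^ n : ℕ) ∧
      GKCurve.intersectionMultiplicity (GKCurve.curveIdeal K q n)
        (GKCurve.surface Z a b c) ΦP = 1) ∧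
    (P = ΦP →
      GKCurve.intersectionMultiplicity (GKCurve.curveIdeal K q n)
        (GKCurve.surface Z a b c) P = (q ^ n + 1 : ℕ)) := by
  subst ht hw hq hr ha hb hc
  have : Fact p.Prime := ⟨hp⟩
  have hm0 : m ≠ 0 := by omega
  have h : GKCurve.IsAdmissible p m n (GKCurve.exponent (p ^ m) n) F Z :=
    { two_le := hp.two_le.trans (Nat.le_self_pow hm0 p)
      cast_eq_zero := by simp [hm0]
      odd := hn
      mul_eq := Nat.div_mul_cancel (by simpa using hn.nat_add_dvd_pow_add_pow (p ^ m) 1)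
      F_eq := hF
      Z_zero := hZ0
      Z_eq := hZ }
  have key := h.surfacePoints_and_multiplicities hPC hΦP
  subst hP
  exact key
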